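/- Let $R$ be a commutative ring with unit containing $\mathbb{Q}$, let $n\ge 0$, and let $G=(G_1,\dots,G_n)$ be power series in $R[[u_1,\dots,u_n]]$. For $X=(X_1,\dots,X_n)$, $u=(u_1,\dots,u_n)$, $\overline u=(\overline u_1,\dots,\overline u_n)$ independent indeterminates, the formal Gaussian integral (with identity covariance) of a monomial is $$\int d\overline u\,du\; e^{-\overline u u}\,\overline u^{\alpha_1}u^{\alpha_2}=\sum_{\sigma}\prod_{k=1}^{|\alpha_1|}\delta_{\tau_2(\sigma(k)),\,\tau_1(k)}\in R,$$ where, for $i=1,2$, $\tau_i:\{1,\dots,|\alpha_i|\}\to\{1,\dots,n\}$ is any map taking each value $j$ exactly $(\alpha_i)_j$ times and $\sigma$ runs over all bijections $\{1,\dots,|\alpha_1|\}\to\{1,\dots,|\alpha_2|\}$. For $U=\sum c_{\alpha_1,\alpha_2,\alpha_3}\overline u^{\alpha_1}u^{\alpha_2}X^{\alpha_3}\in R[[\overline u,u,X]]$ put $$\int d\overline u\,du\; e^{-\overline u u}\,U=\sum_{\alpha_1,\alpha_2,\alpha_3}c_{\alpha_1,\alpha_2,\alpha_3}X^{\alpha_3}\int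 d\overline u\,du\; e^{-\overline u u}\,\overline u^{\alpha_1}u^{\alpha_2}\in R[[X]],$$ which is said to be well defined if for each $\alpha_3$ only finitely many $(\alpha_1,\alpha_2)$ give a nonzero contribution. Write $\overline uXG(u)=\sum_i\overline u_iX_iG_i(u)$, and for multi-indices $\alpha$ write $\alpha!=\prod_i\alpha_i!$, $G(u)^\alpha=\prod_iG_i(u)^{\alpha_i}$. Then there is a unique system $F=(F_1,\dots,F_n)$ of power series in $R[[X_1,\dots,X_n]]$ without constant term such that $F_i=X_i\,G_i(F)$ for $1\le i\le n$. The determinant of the matrix $I-X\partial G(F)=\big(\delta_{ij}-X_i(\partial_jG_i)(F)\big)_{1\le i,j\le n}$ is invertible in $R[[X]]$, and for every monomial $\Omega(u)=u_1^{\beta_1}\cdots u_n^{\beta_n}$ the integral below is well defined and $$\Omega(F)\cdot\frac1{\det\big(I-X\partial G(F)\big)}=\int d\overline u\,du\; e^{-\overline u u}\,\Omega(u)\,e^{\overline uXG(u)}\quad\text{in }R[[X]].$$ Moreover, for every $\alpha\in\mathbb{N}^n$ the integral $\int d\overline u\,du\,e^{-\overline uu}\,\overline u^\alpha\Omega(u)G(u)^\alpha$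 is well defined and equals $\left.\left(\frac{\partial}{\partial u}\right)^{\alpha}\right|_{u=0}\left[\Omega(u)G(u)^\alpha\right]\in R$, and, with a summable right-hand side, $$\int d\overline u\,du\; e^{-\overline u u}\,\Omega(u)\,e^{\overline uXG(u)}=\sum_{\alpha\in\mathbb{N}^n}\frac{X^\alpha}{\alpha!}\left.\left(\frac{\partial}{\partial u}\right)^{\alpha}\right|_{u=0}\left[\Omega(u)G(u)^\alpha\right].$$ -/

import Mathlib

namespace LagrangeGood

/-- Index type of the three vectors of indeterminates `ū`, `u`, `X`, in this order. -/
abbrev Var (n : ℕ) : Type := Fin n ⊕ Fin n ⊕ Fin n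

/-- The position of `ū_i`. -/
def Var.ubar {n : ℕ} (i : Fin n) : Var n := Sum.inl i

/-- The position of `u_i`. -/
def Var.u {n : ℕ} (i : Fin n) : Var n := Sum.inr (Sum.inl i)

/-- The position of `X_i`. -/
def Var.x {n : ℕ} (i : Fin n) : Var n := Sum.inr (Sum.inr i)

/-- The exponent of the monomial `ū^α₁ u^α₂ X^α₃`. -/
noncomputable def triple {n : ℕ} (α₁ α₂ α₃ : Fin n →₀ ℕ) : Var n →₀ ℕ :=
  Finsupp.sumElim α₁ (Finsupp.sumElim α₂ α₃)

/-- Multiindex power `F^α = F_1^{α_1} ⋯ F_n^{α_n}`. -/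
def mpow {n : ℕ} {S : Type*} [CommMonoid S] (F : Fin n → S) (α : Fin n →₀ ℕ) : S :=
  ∏ i, F i ^ α i

/-- `α! = α_1! ⋯ α_n!`. -/
def mfactorial {n : ℕ} (α : Fin n →₀ ℕ) : ℕ := ∏ i, (α i).factorial

section Sums

variable {R : Type*} [CommRing R] {σ ι : Type*}

/-- A family of power series is summable (`R` being discrete) if every monomial occurs with a
nonzero coefficient in only finitely many members. -/
def FormallySummable (f : ι → MvPowerSeries σ R) : Prop :=
  ∀ d : σ →₀ ℕ, {i | MvPowerSeries.coeff d (f i) ≠ 0}.Finite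

/-- The sum of a summable family of power series, coefficient by coefficient. -/
noncomputable def formalSum (f : ι → MvPowerSeries σ R) : MvPowerSeries σ R :=
  fun d => ∑ᶠ i, MvPowerSeries.coeff d (f i)

end Sums

section Gaussian

variable {R : Type*} [CommRing R] {n : ℕ}

/-- The sum over all pairings `s : ι ≃ κ` of the products of the covariances
`[A⁻¹]_{τ₂(s(k)) τ₁(k)}`. -/
noncomputable def wickSum (A : Matrix.GeneralLinearGroup (Fin n) R)
    {ι κ : Type*} [Fintype ι] [Fintype κ] [DecidableEq ι] [DecidableEq κ]
    (τ₁ : ι → Fin n) (τ₂ : κ → Fin n) : R :=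
  ∑ s : ι ≃ κ, ∏ k : ι, (A⁻¹).val (τ₂ (s k)) (τ₁ k)

/-- The formal Gaussian integral of the monomial `ū^α₁ u^α₂` with covariance `A⁻¹`. The list of
indices attached to `α` is the first projection of `Σ i, Fin (α i)`, in which every `i` occurs
exactly `α i` times; any other list with these multiplicities gives the same value
(`wickSum_eq_of_multiplicity`). -/
noncomputable def gaussianMonomial (A : Matrix.GeneralLinearGroup (Fin n) R)
    (α₁ α₂ : Fin n →₀ ℕ) : R :=
  ((Matrix.GeneralLinearGroup.det A)⁻¹ : Rˣ).val *
    wickSum A (Sigma.fst : (Σ i, Fin (α₁ i)) → Fin n) (Sigma.fst : (Σ i, Fin (α₂ i)) → Fin n)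

theorem wickSum_comp (A : Matrix.GeneralLinearGroup (Fin n) R)
    {ι κ ι' κ' : Type*} [Fintype ι] [Fintype κ] [DecidableEq ι] [DecidableEq κ]
    [Fintype ι'] [Fintype κ'] [DecidableEq ι'] [DecidableEq κ']
    (τ₁ : ι → Fin n) (τ₂ : κ → Fin n) (e₁ : ι' ≃ ι) (e₂ : κ' ≃ κ) :
    wickSum A (τ₁ ∘ e₁) (τ₂ ∘ e₂) = wickSum A τ₁ τ₂ := by
  unfold wickSum
  refine Fintype.sum_equiv (Equiv.equivCongr e₁ e₂) _ _ fun s => ?_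
  refine Fintype.prod_equiv e₁ _ _ fun k => ?_
  simp [Equiv.equivCongr]

theorem wickSum_eq_of_multiplicity (A : Matrix.GeneralLinearGroup (Fin n) R)
    (α₁ α₂ : Fin n →₀ ℕ) {k₁ k₂ : ℕ} (τ₁ : Fin k₁ → Fin n) (τ₂ : Fin k₂ → Fin n)
    (h₁ : ∀ i, Fintype.card {k // τ₁ k = i} = α₁ i)
    (h₂ : ∀ i, Fintype.card {k // τ₂ k = i} = α₂ i) :
    ((Matrix.GeneralLinearGroup.det A)⁻¹ : Rˣ).val * wickSum A τ₁ τ₂ =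
      gaussianMonomial A α₁ α₂ := by
  have key : ∀ {k : ℕ} (τ : Fin k → Fin n) (α : Fin n →₀ ℕ),
      (∀ i, Fintype.card {k // τ k = i} = α i) →
      ∃ e : Fin k ≃ (Σ i, Fin (α i)), τ = Sigma.fst ∘ e := by
    intro k τ α h
    refine ⟨(Equiv.sigmaFiberEquiv τ).symm.trans
      (Equiv.sigmaCongrRight fun i => Fintype.equivFinOfCardEq (h i)), ?_⟩
    funext j
    simp [Equiv.sigmaFiberEquiv]
  obtain ⟨e₁, he₁⟩ := key τ₁ α₁ h₁
  obtain ⟨e₂, he₂⟩ := key τ₂ α₂ h₂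
  rw [gaussianMonomial, he₁, he₂, wickSum_comp]

/-- The family of all terms `c_{α₁,α₂,α₃} X^α₃ ∫ e^{-ūAu} ū^α₁ u^α₂` of the formal Gaussian
integral of `U = ∑ c_{α₁,α₂,α₃} ū^α₁ u^α₂ X^α₃`. -/
noncomputable def gaussianTerm (A : Matrix.GeneralLinearGroup (Fin n) R)
    (U : MvPowerSeries (Var n) R)
    (α : (Fin n →₀ ℕ) × (Fin n →₀ ℕ) × (Fin n →₀ ℕ)) : MvPowerSeries (Fin n) R :=
  MvPowerSeries.monomial α.2.2
    (MvPowerSeries.coeff (triple α.1 α.2.1 α.2.2) U * gaussianMonomial A α.1 α.2.1)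

/-- The formal Gaussian integral of `U` is well defined in `R[[X]]`. -/
def GaussianIntegrable (A : Matrix.GeneralLinearGroup (Fin n) R)
    (U : MvPowerSeries (Var n) R) : Prop :=
  FormallySummable (gaussianTerm A U)

/-- The formal Gaussian integral `∫ dū du e^{-ūAu} U` in `R[[X]]`; meaningful when
`GaussianIntegrable A U`. -/
noncomputable def gaussianIntegral (A : Matrix.GeneralLinearGroup (Fin n) R)
    (U : MvPowerSeries (Var n) R) : MvPowerSeries (Fin n) R :=
  formalSum (gaussianTerm A U)

end Gaussian

section Series

variable {R : Type*} [CommRing R] {n : ℕ}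

/-- `H(u)` as an element of `R[[ū, u, X]]`. -/
noncomputable def inU (H : MvPowerSeries (Fin n) R) : MvPowerSeries (Var n) R :=
  MvPowerSeries.subst (fun j => (MvPowerSeries.X (Var.u j) : MvPowerSeries (Var n) R)) H

/-- `e^{ūXG(u)}` in `R[[ū, u, X]]`, where `ūXG(u) = ∑ i, ū_i X_i G_i(u)`. -/
noncomputable def expInteraction [Algebra ℚ R] (G : Fin n → MvPowerSeries (Fin n) R) :
    MvPowerSeries (Var n) R :=
  PowerSeries.subst
    (∑ i, MvPowerSeries.X (Var.ubar i) * MvPowerSeries.X (Var.x i) * inU (G i) :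
      MvPowerSeries (Var n) R)
    (PowerSeries.exp R)

/-- `F` has no constant terms and satisfies `F_i = X_i G_i(F)` for all `i`. -/
def IsImplicitSolution (G F : Fin n → MvPowerSeries (Fin n) R) : Prop :=
  (∀ i, MvPowerSeries.constantCoeff (F i) = 0) ∧
    ∀ i, F i = MvPowerSeries.X i * MvPowerSeries.subst F (G i)

/-- The matrix `X∂G(F)` with entries `X_i (∂_j G_i)(F)`. -/
noncomputable def xJacobian (G F : Fin n → MvPowerSeries (Fin n) R) :
    Matrix (Fin n) (Fin n) (MvPowerSeries (Fin n) R) :=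
  Matrix.of fun i j => MvPowerSeries.X i * MvPowerSeries.subst F (MvPowerSeries.pderiv R j (G i))

/-- `(∂/∂u)^α H` evaluated at `u = 0`. -/
noncomputable def derivAtZero (α : Fin n →₀ ℕ) (H : MvPowerSeries (Fin n) R) : R :=
  MvPowerSeries.constantCoeff
    ((List.finRange n).foldr (fun i K => (MvPowerSeries.pderiv R i)^[α i] K) H)

end Series

end LagrangeGood

open LagrangeGood

/-!
Put `L(H) = ∑_α X^α [u^α] (H(u) G(u)^α)`. Shifting `α` gives `L(u_i H) = X_i L(G_i H)`, which is
also the rule for substituting a solution `F` of `F_i = X_i G_i(F)`, and a linear map obeying it is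
determined by its value at `1`. So `H ↦ L(H) / L(1)` is multiplicative, it is substitution of the
series `F_i = L(u_i) / L(1)`, and these form the only solution.

It remains to see that `det(I - X∂G(F)) L(1) = 1`. Multiplying `L` by the entries of the matrix
only changes the factors of `G^α`, so the coefficient of `X^α` in the product is `[u^α]` of a
determinant. Up to a nonzero integer, this is a combination of integer determinants in which the
rows indexed by the support of `α` add up to zero.

On the integral side, the Gaussian pairing of `ū^α` and `u^β` is `α!` if `α = β` and `0` otherwise,
so the integral of `Ω e^{ūXG}` is `L(Ω)`, while `[u^α] = (∂/∂u)^α|_{u=0} / α!`.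
-/

namespace LagrangeGood

open MvPowerSeries

section LinearMaps

variable {R σ τ : Type*} [CommRing R]

theorem coeff_add_single_X_mul (i : σ) (H : MvPowerSeries σ R) (d : σ →₀ ℕ) :
    coeff (d + Finsupp.single i 1) (X i * H) = coeff d H := by
  rw [add_comm, X_def, coeff_add_monomial_mul, one_mul]

theorem coeff_X_mul_of_eq_zero {i : σ} {d : σ →₀ ℕ} (hd : d i = 0) (H : MvPowerSeries σ R) :
    coeff d (X i * H) = 0 := by
  classical
  rw [X_def, coeff_monomial_mul, if_neg (by simp [hd])]

theorem exists_eq_add_single_one {d : σ →₀ ℕ} {i : σ} (hd : d i ≠ 0) :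
    ∃ e, d = e + Finsupp.single i 1 :=
  ⟨d - Finsupp.single i 1, (tsub_add_cancel_of_le (by simpa [Nat.one_le_iff_ne_zero])).symm⟩

theorem exists_eq_C_add_sum_X_mul [Fintype σ] (H : MvPowerSeries σ R) :
    ∃ K : σ → MvPowerSeries σ R, H = C (constantCoeff H) + ∑ i, X i * K i := by
  classical
  have hvar (d : σ →₀ ℕ) (hd : d ≠ 0) : ∃ i, d i ≠ 0 := by simpa using DFunLike.ne_iff.1 hd
  choose v hv using hvar
  -- `X i * K i` collects the monomials of `H` whose chosen variable is `i`.
  let K (i : σ) : MvPowerSeries σ R := fun d =>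
    if v (d + Finsupp.single i 1) (by simp) = i then coeff (d + Finsupp.single i 1) H else 0
  have hK (d : σ →₀ ℕ) (hd : d ≠ 0) (i : σ) :
      coeff d (X i * K i) = if v d hd = i then coeff d H else 0 := by
    by_cases hi : d i = 0
    · rw [coeff_X_mul_of_eq_zero hi, if_neg (by rintro rfl; exact hv d hd hi)]
    · obtain ⟨e, rfl⟩ := exists_eq_add_single_one hi
      rw [coeff_add_single_X_mul]
      rfl
  refine ⟨K, ?_⟩
  ext d
  by_cases hd : d = 0
  · simp [hd]
  · simp [coeff_C, hd, hK d hd]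

-- A series without constant term is `∑ i, X i * K i`, so `h_X_mul` raises the order of `f H - g H`
-- indefinitely.
theorem linearMap_ext_of_X_mul [Finite σ] {f g : MvPowerSeries σ R →ₗ[R] MvPowerSeries τ R}
    (h_one : f 1 = g 1)
    (h_X_mul : ∀ i H, ∃ c K, constantCoeff c = 0 ∧ f (X i * H) = c * f K ∧ g (X i * H) = c * g K) :
    f = g := by
  have := Fintype.ofFinite σ
  have le_order (m : ℕ) : ∀ H, (m : ℕ∞) ≤ (f H - g H).order := by
    induction m with
    | zero => simp
    | succ m ih =>
      intro H
      obtain ⟨K, hK⟩ := exists_eq_C_add_sum_X_mul H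
      have h_C : f (C (constantCoeff H)) = g (C (constantCoeff H)) := by
        rw [← mul_one (C _), ← smul_eq_C_mul, map_smul, map_smul, h_one]
      have h_sum : f H - g H = ∑ i, (f (X i * K i) - g (X i * K i)) := by
        rw [hK, map_add, map_add, h_C, add_sub_add_left_eq_sub, map_sum, map_sum,
          Finset.sum_sub_distrib]
      rw [h_sum]
      refine nat_le_order fun d hd => ?_
      rw [map_sum]
      refine Finset.sum_eq_zero fun i _ => coeff_of_lt_order ?_
      obtain ⟨c, L, hc, hf, hg⟩ := h_X_mul i (K i)
      calc (d.degree : ℕ∞) < m + 1 := mod_cast hd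
        _ ≤ (f L - g L).order + c.order :=
          add_le_add (ih L) (one_le_order_iff_constCoeff_eq_zero.2 hc)
        _ ≤ (f (X i * K i) - g (X i * K i)).order := by
          rw [hf, hg, ← mul_sub, add_comm]
          exact le_order_mul
  ext H d
  rw [← sub_eq_zero, ← map_sub]
  exact coeff_of_lt_order ((Nat.cast_lt.2 d.degree.lt_succ_self).trans_le (le_order _ H))

theorem algHom_apply_eq_subst [Finite σ] (φ : MvPowerSeries σ R →ₐ[R] MvPowerSeries τ R)
    (hφ : ∀ i, constantCoeff (φ (X i)) = 0) (H : MvPowerSeries σ R) :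
    φ H = subst (fun i => φ (X i)) H := by
  have hs : HasSubst fun i => φ (X i) := hasSubst_of_constantCoeff_zero hφ
  have h : φ.toLinearMap = (substAlgHom (R := R) hs).toLinearMap := by
    refine linearMap_ext_of_X_mul (by simp only [AlgHom.toLinearMap_apply, map_one])
      fun i H => ⟨φ (X i), H, hφ i, ?_⟩
    simp only [AlgHom.toLinearMap_apply, map_mul, substAlgHom_X, and_self]
  rw [← coe_substAlgHom (R := R) hs]
  exact LinearMap.congr_fun h H

end LinearMaps

section DiagonalSeries

variable {R σ : Type*} [CommRing R] [Fintype σ]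

/-- The diagonal extraction `∑_α X^α [u^α] (H(u) ∏_i A_{i, α_i}(u))` for a doubly indexed family
`A` of power series. The general weights are needed for the Jacobian, where the factors are not
powers of a fixed series. -/
noncomputable def diagonalSeries (A : σ → ℕ → MvPowerSeries σ R) :
    MvPowerSeries σ R →ₗ[R] MvPowerSeries σ R where
  toFun H := fun α => coeff α (H * ∏ i, A i (α i))
  map_add' H K := by
    ext α
    change coeff α ((H + K) * _) = coeff α (H * _) + coeff α (K * _)
    rw [add_mul, map_add]
  map_smul' r H := by
    ext α
    change coeff α ((r • H) * _) = r * coeff α (H * _)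
    rw [smul_mul_assoc, coeff_smul]

theorem coeff_diagonalSeries (A : σ → ℕ → MvPowerSeries σ R) (H : MvPowerSeries σ R)
    (α : σ →₀ ℕ) : coeff α (diagonalSeries A H) = coeff α (H * ∏ i, A i (α i)) := rfl

theorem coeff_add_single_X_mul_diagonalSeries (A : σ → ℕ → MvPowerSeries σ R) (i : σ)
    (H : MvPowerSeries σ R) (α : σ →₀ ℕ) :
    coeff (α + Finsupp.single i 1) (X i * diagonalSeries A H) =
      coeff (α + Finsupp.single i 1) (X i * (H * ∏ j, A j (α j))) := by
  rw [coeff_add_single_X_mul, coeff_add_single_X_mul, coeff_diagonalSeries]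

theorem prod_apply_add_single_one {M : Type*} [CommMonoid M] [DecidableEq σ] (A : σ → ℕ → M)
    (i : σ) (α : σ →₀ ℕ) :
    ∏ j, A j ((α + Finsupp.single i 1 : σ →₀ ℕ) j) =
      A i (α i + 1) * ∏ j ∈ {i}ᶜ, A j (α j) := by
  rw [Fintype.prod_eq_mul_prod_compl i]
  congr! 2 with j hj
  · simp
  · simp [show j ≠ i by simpa using hj]

/-- The Lagrange transform `H ↦ ∑_α X^α [u^α] (H(u) G(u)^α)`. It turns out to be
`H ↦ H(F) / det(I - X∂G(F))`. -/
noncomputable def lagrangeSeries (G : σ → MvPowerSeries σ R) :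
    MvPowerSeries σ R →ₗ[R] MvPowerSeries σ R :=
  diagonalSeries fun i k => G i ^ k

theorem coeff_lagrangeSeries (G : σ → MvPowerSeries σ R) (H : MvPowerSeries σ R)
    (α : σ →₀ ℕ) : coeff α (lagrangeSeries G H) = coeff α (H * ∏ i, G i ^ α i) := rfl

theorem lagrangeSeries_X_mul (G : σ → MvPowerSeries σ R) (i : σ) (H : MvPowerSeries σ R) :
    lagrangeSeries G (X i * H) = X i * lagrangeSeries G (G i * H) := by
  classical
  ext α
  by_cases hi : α i = 0
  · rw [coeff_X_mul_of_eq_zero hi, coeff_lagrangeSeries, mul_assoc, coeff_X_mul_of_eq_zero hi]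
  · obtain ⟨e, rfl⟩ := exists_eq_add_single_one hi
    rw [lagrangeSeries, coeff_add_single_X_mul_diagonalSeries, coeff_diagonalSeries,
      prod_apply_add_single_one fun j k => G j ^ k, Fintype.prod_eq_mul_prod_compl i, pow_succ]
    congr 1
    ring

theorem constantCoeff_lagrangeSeries_one (G : σ → MvPowerSeries σ R) :
    constantCoeff (lagrangeSeries G 1) = 1 := by
  rw [← coeff_zero_eq_constantCoeff_apply, coeff_lagrangeSeries]
  simp

theorem isUnit_lagrangeSeries_one (G : σ → MvPowerSeries σ R) : IsUnit (lagrangeSeries G 1) := by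
  rw [isUnit_iff_constantCoeff, constantCoeff_lagrangeSeries_one]
  exact isUnit_one

theorem lagrangeSeries_mul_mul_lagrangeSeries_one (G : σ → MvPowerSeries σ R)
    (H K : MvPowerSeries σ R) :
    lagrangeSeries G (H * K) * lagrangeSeries G 1 = lagrangeSeries G H * lagrangeSeries G K := by
  have h : LinearMap.mulRight R (lagrangeSeries G 1) ∘ₗ lagrangeSeries G ∘ₗ LinearMap.mulRight R K =
      LinearMap.mulRight R (lagrangeSeries G K) ∘ₗ lagrangeSeries G := by
    refine linearMap_ext_of_X_mul (by simp [mul_comm])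
      fun i H => ⟨X i, G i * H, constantCoeff_X i, ?_⟩
    simp [mul_assoc, lagrangeSeries_X_mul]
  exact LinearMap.congr_fun h H

/-- The Lagrange transform normalised to be multiplicative; it is substitution of the implicit
solution `F`. -/
noncomputable def lagrangeAlgHom (G : σ → MvPowerSeries σ R) :
    MvPowerSeries σ R →ₐ[R] MvPowerSeries σ R :=
  AlgHom.ofLinearMap (LinearMap.mulRight R (Ring.inverse (lagrangeSeries G 1)) ∘ₗ lagrangeSeries G)
    (Ring.mul_inverse_cancel _ (isUnit_lagrangeSeries_one G)) fun H K => by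
      have h_inv := Ring.mul_inverse_cancel _ (isUnit_lagrangeSeries_one G)
      simp only [LinearMap.comp_apply, LinearMap.mulRight_apply]
      linear_combination
        Ring.inverse (lagrangeSeries G 1) ^ 2 * lagrangeSeries_mul_mul_lagrangeSeries_one G H K -
          lagrangeSeries G (H * K) * Ring.inverse (lagrangeSeries G 1) * h_inv

theorem lagrangeAlgHom_mul_lagrangeSeries_one (G : σ → MvPowerSeries σ R) (H : MvPowerSeries σ R) :
    lagrangeAlgHom G H * lagrangeSeries G 1 = lagrangeSeries G H :=
  Ring.inverse_mul_cancel_right _ _ (isUnit_lagrangeSeries_one G)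

theorem lagrangeAlgHom_X_mul (G : σ → MvPowerSeries σ R) (i : σ) (H : MvPowerSeries σ R) :
    lagrangeAlgHom G (X i * H) = X i * lagrangeAlgHom G (G i * H) := by
  change lagrangeSeries G (X i * H) * _ = X i * (lagrangeSeries G (G i * H) * _)
  rw [lagrangeSeries_X_mul, mul_assoc]

end DiagonalSeries

section ImplicitSolution

variable {R : Type*} [CommRing R] {n : ℕ} {G F : Fin n → MvPowerSeries (Fin n) R}

theorem IsImplicitSolution.hasSubst (hF : IsImplicitSolution G F) : HasSubst F :=
  hasSubst_of_constantCoeff_zero hF.1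

theorem IsImplicitSolution.lagrangeAlgHom_apply (hF : IsImplicitSolution G F)
    (H : MvPowerSeries (Fin n) R) : lagrangeAlgHom G H = subst F H := by
  have h : (lagrangeAlgHom G).toLinearMap = (substAlgHom (R := R) hF.hasSubst).toLinearMap := by
    refine linearMap_ext_of_X_mul (by simp only [AlgHom.toLinearMap_apply, map_one])
      fun i H => ⟨X i, G i * H, constantCoeff_X i, lagrangeAlgHom_X_mul G i H, ?_⟩
    simp only [AlgHom.toLinearMap_apply, coe_substAlgHom, subst_mul hF.hasSubst,
      subst_X hF.hasSubst, ← mul_assoc, ← hF.2 i]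
  rw [← coe_substAlgHom (R := R) hF.hasSubst]
  exact LinearMap.congr_fun h H

theorem isImplicitSolution_lagrangeAlgHom_X (G : Fin n → MvPowerSeries (Fin n) R) :
    IsImplicitSolution G fun i => lagrangeAlgHom G (X i) := by
  have hX (i : Fin n) : lagrangeAlgHom G (X i) = X i * lagrangeAlgHom G (G i) := by
    simpa using lagrangeAlgHom_X_mul G i 1
  have h₀ (i : Fin n) : constantCoeff (lagrangeAlgHom G (X i)) = 0 := by simp [hX]
  exact ⟨h₀, fun i => (hX i).trans (by rw [← algHom_apply_eq_subst _ h₀])⟩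

theorem existsUnique_isImplicitSolution (G : Fin n → MvPowerSeries (Fin n) R) :
    ∃! F : Fin n → MvPowerSeries (Fin n) R, IsImplicitSolution G F :=
  ⟨_, isImplicitSolution_lagrangeAlgHom_X G, fun F hF => funext fun i => by
    rw [hF.lagrangeAlgHom_apply, subst_X hF.hasSubst]⟩

theorem IsImplicitSolution.lagrangeSeries_eq_subst_mul (hF : IsImplicitSolution G F)
    (H : MvPowerSeries (Fin n) R) : lagrangeSeries G H = subst F H * lagrangeSeries G 1 := by
  rw [← hF.lagrangeAlgHom_apply, lagrangeAlgHom_mul_lagrangeSeries_one]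

end ImplicitSolution

section Jacobian

variable {R σ : Type*} [CommRing R]

theorem diagonalSeries_update [Fintype σ] [DecidableEq σ] {A : σ → ℕ → MvPowerSeries σ R} {i : σ}
    {B : ℕ → MvPowerSeries σ R} {c : R} {K : MvPowerSeries σ R} (h_zero : B 0 = C c * A i 0)
    (h_succ : ∀ k, B (k + 1) = C c * A i (k + 1) - X i * (K * A i k)) (H : MvPowerSeries σ R) :
    diagonalSeries (Function.update A i B) H =
      C c * diagonalSeries A H - X i * diagonalSeries A (K * H) := by
  have h_compl (α : σ →₀ ℕ) :
      ∏ j ∈ {i}ᶜ, Function.update A i B j (α j) = ∏ j ∈ {i}ᶜ, A j (α j) :=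
    Finset.prod_congr rfl fun j hj => by
      rw [Function.update_of_ne (by simpa using hj)]
  ext α
  rw [map_sub, coeff_C_mul]
  by_cases hi : α i = 0
  · rw [coeff_X_mul_of_eq_zero hi, sub_zero, coeff_diagonalSeries, coeff_diagonalSeries,
      ← coeff_C_mul, Fintype.prod_eq_mul_prod_compl i, Fintype.prod_eq_mul_prod_compl i, h_compl,
      Function.update_self, hi, h_zero]
    congr 1
    ring
  · obtain ⟨e, rfl⟩ := exists_eq_add_single_one hi
    rw [coeff_add_single_X_mul_diagonalSeries, coeff_diagonalSeries, coeff_diagonalSeries,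
      ← coeff_C_mul, ← map_sub, prod_apply_add_single_one, prod_apply_add_single_one, h_compl,
      Function.update_self, h_succ, Fintype.prod_eq_mul_prod_compl i]
    congr 1
    ring

/-- The series which has to replace `g ^ k` as the `i`-th factor of the Lagrange transform in order
to multiply the transform by `c - X_i K(F)`. -/
noncomputable def rowFactor (g K : MvPowerSeries σ R) (c : R) (i : σ) : ℕ → MvPowerSeries σ R
  | 0 => C c
  | k + 1 => C c * g ^ (k + 1) - X i * (K * g ^ k)

theorem natCast_mul_rowFactor_pderiv (g : MvPowerSeries σ R) (c : R) (i j : σ) (k : ℕ) :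
    ((max k 1 : ℕ) : MvPowerSeries σ R) * rowFactor g (pderiv R j g) c i k =
      C (c * (max k 1 : ℕ)) * g ^ k - X i * pderiv R j (g ^ k) := by
  rw [pderiv_pow, map_mul, map_natCast]
  cases k with
  | zero => simp [rowFactor]
  | succ k =>
    rw [max_eq_left k.succ_pos, rowFactor, Nat.add_sub_cancel]
    ring

theorem coeff_X_mul_pderiv (j : σ) (H : MvPowerSeries σ R) (γ : σ →₀ ℕ) :
    coeff γ (X j * pderiv R j H) = γ j * coeff γ H := by
  by_cases hj : γ j = 0
  · rw [coeff_X_mul_of_eq_zero hj, hj, Nat.cast_zero, zero_mul]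
  · obtain ⟨e, rfl⟩ := exists_eq_add_single_one hj
    rw [coeff_add_single_X_mul, coeff_pderiv]
    simp [mul_comm]

variable [Fintype σ] [DecidableEq σ]

-- Conjugation by `diag(X)` turns `X_i ∂_j` into `X_j ∂_j`, which is diagonal on monomials; the row
-- weights are `max (α i) 1` rather than `α i` so that they stay cancellable where `α i = 0`.
theorem prod_natCast_mul_det_rowFactor (G : σ → MvPowerSeries σ R) (α : σ →₀ ℕ) :
    (∏ i, ((max (α i) 1 : ℕ) : MvPowerSeries σ R)) *
        (Matrix.of fun i j =>
          rowFactor (G i) (pderiv R j (G i)) ((1 : Matrix σ σ R) i j) i (α i)).det =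
      (Matrix.of fun i j => C ((1 : Matrix σ σ R) i j * (max (α i) 1 : ℕ)) *
        G i ^ α i - X j * pderiv R j (G i ^ α i)).det := by
  set m : σ → ℕ := fun i => max (α i) 1
  set M : Matrix σ σ (MvPowerSeries σ R) := Matrix.of fun i j =>
    rowFactor (G i) (pderiv R j (G i)) ((1 : Matrix σ σ R) i j) i (α i)
  set N : Matrix σ σ (MvPowerSeries σ R) := Matrix.of fun i j =>
    C ((1 : Matrix σ σ R) i j * m i) * G i ^ α i - X j * pderiv R j (G i ^ α i)
  have h_conj : Matrix.diagonal (fun i => (m i : MvPowerSeries σ R)) * M *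
      Matrix.diagonal (fun i => X i) = Matrix.diagonal (fun i => X i) * N := by
    ext i j : 1
    rw [Matrix.mul_diagonal, Matrix.diagonal_mul, Matrix.diagonal_mul]
    simp only [M, N, m, Matrix.of_apply]
    rw [natCast_mul_rowFactor_pderiv]
    rcases eq_or_ne i j with rfl | hij
    · ring
    · simp only [Matrix.one_apply_ne hij, zero_mul, map_zero]
      ring
  have h_det := congr_arg Matrix.det h_conj
  rw [Matrix.det_mul, Matrix.det_mul, Matrix.det_mul, Matrix.det_diagonal, Matrix.det_diagonal,
    mul_comm] at h_det
  have h_X : ∏ i : σ, (X i : MvPowerSeries σ R) ∈ nonZeroDivisors (MvPowerSeries σ R) :=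
    prod_mem fun i _ => X_mem_nonzeroDivisors
  exact (mul_cancel_left_mem_nonZeroDivisors h_X).1 h_det

theorem coeff_det_of_C_mul_sub_X_mul_pderiv (H : σ → MvPowerSeries σ R) (m : σ → ℕ)
    (α : σ →₀ ℕ) :
    coeff α (Matrix.of fun i j =>
      C ((1 : Matrix σ σ R) i j * m i) * H i - X j * pderiv R j (H i)).det =
      ∑ γ ∈ Finset.finsuppAntidiag Finset.univ α,
        ((Matrix.diagonal (fun i => (m i : ℤ)) - Matrix.of fun i j => (γ i j : ℤ)).det : R) *
          ∏ i, coeff (γ i) (H i) := by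
  have h_entry (i j : σ) (γ : σ →₀ ℕ) :
      coeff γ (C ((1 : Matrix σ σ R) i j * m i) * H i - X j * pderiv R j (H i)) =
        ((Matrix.diagonal (fun i => (m i : ℤ)) i j - γ j : ℤ) : R) * coeff γ (H i) := by
    rw [map_sub, coeff_C_mul, coeff_X_mul_pderiv, Matrix.one_apply, Matrix.diagonal_apply]
    split_ifs <;> push_cast <;> ring
  simp only [← Matrix.det_transpose (Matrix.of _), ← Matrix.det_transpose (_ - _),
    Matrix.det_apply', Int.cast_sum, Finset.sum_mul, map_sum]
  rw [Finset.sum_comm]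
  refine Finset.sum_congr rfl fun s _ => ?_
  rw [← map_intCast (C (σ := σ) (R := R)), coeff_C_mul, coeff_prod, Finset.mul_sum]
  refine Finset.sum_congr rfl fun γ _ => ?_
  simp only [Matrix.transpose_apply, Matrix.of_apply, Matrix.sub_apply, h_entry,
    Finset.prod_mul_distrib, Int.cast_mul, Int.cast_prod, Int.cast_id, mul_assoc]

theorem det_diagonal_sub_eq_zero {α : σ →₀ ℕ} (hα : α ≠ 0) {γ : σ → σ →₀ ℕ}
    (h_sum : ∑ i, γ i = α) (h_zero : ∀ i, α i = 0 → γ i = 0) :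
    (Matrix.diagonal (fun i => ((max (α i) 1 : ℕ) : ℤ)) -
      Matrix.of fun i j => (γ i j : ℤ)).det = 0 := by
  -- The rows indexed by the support of `α` add up to zero.
  rw [← Matrix.exists_vecMul_eq_zero_iff]
  refine ⟨fun i => if α i = 0 then 0 else 1, fun h => hα ?_, ?_⟩
  · ext i
    simpa using congr_fun h i
  · have h_col (j : σ) : ∑ i, (if α i = 0 then 0 else 1) * (γ i j : ℤ) = α j := by
      rw [← h_sum, Finsupp.finsetSum_apply, Nat.cast_sum, h_sum]
      refine Finset.sum_congr rfl fun i _ => ?_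
      by_cases hi : α i = 0 <;> simp [hi, h_zero]
    ext j
    rw [Matrix.vecMul_sub, Pi.sub_apply, Matrix.vecMul_diagonal]
    simp only [Matrix.vecMul, dotProduct, Matrix.of_apply, h_col]
    by_cases hj : α j = 0 <;> simp [hj, Nat.one_le_iff_ne_zero]

theorem coeff_det_rowFactor [IsAddTorsionFree R] (G : σ → MvPowerSeries σ R) {α : σ →₀ ℕ}
    (hα : α ≠ 0) :
    coeff α (Matrix.of fun i j =>
      rowFactor (G i) (pderiv R j (G i)) ((1 : Matrix σ σ R) i j) i (α i)).det = 0 := by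
  have h_mul := congr_arg (coeff α) (prod_natCast_mul_det_rowFactor G α)
  rw [coeff_det_of_C_mul_sub_X_mul_pderiv, Finset.sum_eq_zero] at h_mul
  · rw [← Nat.cast_prod, ← nsmul_eq_mul, map_nsmul] at h_mul
    exact (smul_eq_zero_iff_right (Finset.prod_ne_zero_iff.2 fun i _ => by positivity)).1 h_mul
  · intro γ hγ
    by_cases h_zero : ∀ i, α i = 0 → γ i = 0
    · rw [det_diagonal_sub_eq_zero hα (Finset.mem_finsuppAntidiag.1 hγ).1 h_zero, Int.cast_zero,
        zero_mul]
    · push Not at h_zero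
      obtain ⟨i, hi, hγi⟩ := h_zero
      rw [Finset.prod_eq_zero (Finset.mem_univ i), mul_zero]
      rw [hi, pow_zero, coeff_one, if_neg hγi]

end Jacobian

section ImplicitJacobian

variable {R : Type*} [CommRing R] {n : ℕ} {G F : Fin n → MvPowerSeries (Fin n) R}

theorem IsImplicitSolution.diagonalSeries_rowFactor (hF : IsImplicitSolution G F)
    (K : Fin n → MvPowerSeries (Fin n) R) (c : Fin n → R) (H : MvPowerSeries (Fin n) R) :
    diagonalSeries (fun i => rowFactor (G i) (K i) (c i) i) H =
      (∏ i, (C (c i) - X i * subst F (K i))) * lagrangeSeries G H := by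
  let A (s : Finset (Fin n)) : Fin n → ℕ → MvPowerSeries (Fin n) R := fun i =>
    if i ∈ s then rowFactor (G i) (K i) (c i) i else fun k => G i ^ k
  suffices h : ∀ s H, diagonalSeries (A s) H =
      (∏ i ∈ s, (C (c i) - X i * subst F (K i))) * lagrangeSeries G H by
    simpa [A] using h Finset.univ H
  intro s
  induction s using Finset.induction_on with
  | empty => intro H; simp [A, lagrangeSeries]
  | insert i s hi ih =>
    intro H
    have h_insert : A (insert i s) =
        Function.update (A s) i (rowFactor (G i) (K i) (c i) i) := by
      ext1 j
      rcases eq_or_ne j i with rfl | hj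
      · simp [A]
      · simp [A, hj]
    rw [h_insert, diagonalSeries_update (c := c i) (K := K i), ih, ih, Finset.prod_insert hi,
      hF.lagrangeSeries_eq_subst_mul (K i * H), hF.lagrangeSeries_eq_subst_mul H,
      subst_mul hF.hasSubst]
    · ring
    · simp [A, hi, rowFactor]
    · simp [A, hi, rowFactor]

theorem IsImplicitSolution.coeff_det_mul_lagrangeSeries_one (hF : IsImplicitSolution G F)
    (α : Fin n →₀ ℕ) :
    coeff α ((1 - xJacobian G F).det * lagrangeSeries G 1) =
      coeff α (Matrix.of fun i j => rowFactor (G i) (pderiv R j (G i))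
        ((1 : Matrix (Fin n) (Fin n) R) i j) i (α i)).det := by
  rw [← Matrix.det_transpose, ← Matrix.det_transpose (Matrix.of _), Matrix.det_apply',
    Matrix.det_apply', Finset.sum_mul, map_sum, map_sum]
  refine Finset.sum_congr rfl fun s _ => ?_
  have h_prod : ∏ i, (1 - xJacobian G F).transpose (s i) i = ∏ i,
      (C ((1 : Matrix (Fin n) (Fin n) R) i (s i)) - X i * subst F (pderiv R (s i) (G i))) := by
    refine Finset.prod_congr rfl fun i _ => ?_
    simp [xJacobian, Matrix.one_apply, apply_ite C]
  rw [h_prod, mul_assoc, ← hF.diagonalSeries_rowFactor, ← map_intCast (C (σ := Fin n) (R := R)),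
    coeff_C_mul, coeff_C_mul, coeff_diagonalSeries, one_mul]
  rfl

variable [IsAddTorsionFree R]

theorem IsImplicitSolution.det_mul_lagrangeSeries_one (hF : IsImplicitSolution G F) :
    (1 - xJacobian G F).det * lagrangeSeries G 1 = 1 := by
  ext α
  rw [hF.coeff_det_mul_lagrangeSeries_one, coeff_one]
  split_ifs with hα
  · have h_one : (Matrix.of fun i j => rowFactor (G i) (pderiv R j (G i))
        ((1 : Matrix (Fin n) (Fin n) R) i j) i (α i)) = 1 := by
      ext i j : 1
      simp [hα, rowFactor, Matrix.one_apply, apply_ite C]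
    rw [h_one, Matrix.det_one, hα, coeff_zero_one]
  · exact coeff_det_rowFactor G hα

theorem IsImplicitSolution.isUnit_det (hF : IsImplicitSolution G F) :
    IsUnit (1 - xJacobian G F).det :=
  IsUnit.of_mul_eq_one _ hF.det_mul_lagrangeSeries_one

theorem IsImplicitSolution.lagrangeSeries_eq_subst_mul_inverse_det (hF : IsImplicitSolution G F)
    (H : MvPowerSeries (Fin n) R) :
    lagrangeSeries G H = subst F H * Ring.inverse (1 - xJacobian G F).det := by
  rw [hF.lagrangeSeries_eq_subst_mul H, Ring.eq_mul_inverse_iff_mul_eq _ _ _ hF.isUnit_det,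
    mul_assoc, mul_comm (lagrangeSeries G 1), hF.det_mul_lagrangeSeries_one, mul_one]

end ImplicitJacobian

section MultiIndices

variable {n : ℕ}

theorem map_mpow {S T Φ : Type*} [CommMonoid S] [CommMonoid T] [FunLike Φ S T]
    [MonoidHomClass Φ S T] (φ : Φ) (F : Fin n → S) (α : Fin n →₀ ℕ) :
    φ (mpow F α) = mpow (fun i => φ (F i)) α := by
  simp only [mpow, map_prod, map_pow]

theorem algebraMap_one_div_mfactorial_mul {R : Type*} [CommRing R] [Algebra ℚ R]
    (α : Fin n →₀ ℕ) : algebraMap ℚ R (1 / mfactorial α) * mfactorial α = 1 := by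
  have h : (mfactorial α : ℚ) ≠ 0 :=
    Nat.cast_ne_zero.2 (Finset.prod_ne_zero_iff.2 fun i _ => (α i).factorial_ne_zero)
  rw [← map_natCast (algebraMap ℚ R), ← map_mul, one_div_mul_cancel h, map_one]

theorem algebraMap_one_div_degree_factorial_mul_multinomial {R : Type*} [CommRing R] [Algebra ℚ R]
    (α : Fin n →₀ ℕ) :
    algebraMap ℚ R (1 / (α.degree.factorial : ℚ)) * Nat.multinomial Finset.univ α =
      algebraMap ℚ R (1 / mfactorial α) := by
  have h_ne : (Nat.multinomial Finset.univ α : ℚ) ≠ 0 :=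
    Nat.cast_ne_zero.2 (Nat.multinomial_pos _ _).ne'
  rw [← map_natCast (algebraMap ℚ R), ← map_mul, Finsupp.degree_eq_sum, ← Nat.multinomial_spec,
    Nat.cast_mul, one_div, mul_inv, inv_mul_cancel_right₀ h_ne, one_div, mfactorial]

theorem subst_mpow_X {R τ : Type*} [CommRing R] {F : Fin n → MvPowerSeries τ R} (hF : HasSubst F)
    (α : Fin n →₀ ℕ) : subst F (mpow (X (R := R)) α) = mpow F α := by
  rw [← coe_substAlgHom (R := R) hF, map_mpow]
  simp only [substAlgHom_X]

end MultiIndices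

section DerivAtZero

variable {R σ : Type*} [CommRing R]

theorem coeff_iterate_pderiv (i : σ) (k : ℕ) (H : MvPowerSeries σ R) (d : σ →₀ ℕ) :
    coeff d ((pderiv R i)^[k] H) =
      (d i + 1).ascFactorial k * coeff (d + Finsupp.single i k) H := by
  induction k generalizing d with
  | zero => simp
  | succ k ih =>
    rw [Function.iterate_succ_apply', coeff_pderiv, ih, add_assoc d, ← Finsupp.single_add,
      add_comm 1 k, Nat.ascFactorial_succ, ← Nat.succ_ascFactorial, Finsupp.add_apply,
      Finsupp.single_eq_same]
    push_cast
    ring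

theorem coeff_foldr_pderiv (α : σ →₀ ℕ) (H : MvPowerSeries σ R) {l : List σ} (hl : l.Nodup)
    {d : σ →₀ ℕ} (hd : ∀ i ∈ l, d i = 0) :
    coeff d (l.foldr (fun i K => (pderiv R i)^[α i] K) H) =
      ((l.map fun i => (α i).factorial).prod : ℕ) *
        coeff (d + (l.map fun i => Finsupp.single i (α i)).sum) H := by
  induction l generalizing d with
  | nil => simp
  | cons i l ih =>
    rw [List.nodup_cons] at hl
    have hd' : ∀ j ∈ l, (d + Finsupp.single i (α i)) j = 0 := fun j hj => by
      have hij : i ≠ j := fun h => hl.1 (h ▸ hj)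
      simp [hd j (List.mem_cons_of_mem _ hj), hij]
    rw [List.foldr_cons, coeff_iterate_pderiv, ih hl.2 hd', hd i List.mem_cons_self, zero_add,
      Nat.one_ascFactorial, List.map_cons, List.prod_cons, List.map_cons, List.sum_cons,
      Nat.cast_mul, mul_assoc, add_assoc]

theorem derivAtZero_eq {n : ℕ} (α : Fin n →₀ ℕ) (H : MvPowerSeries (Fin n) R) :
    derivAtZero α H = mfactorial α * coeff α H := by
  rw [derivAtZero, ← coeff_zero_eq_constantCoeff_apply,
    coeff_foldr_pderiv α H (List.nodup_finRange n) fun _ _ => rfl, ← Fin.prod_univ_def,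
    ← Fin.sum_univ_def, Finsupp.univ_sum_single, zero_add, mfactorial]

end DerivAtZero

section Wick

variable {R : Type*} [CommRing R] {n : ℕ}

theorem card_sigma_fin_fiber (α : Fin n →₀ ℕ) (i : Fin n) :
    Fintype.card {k : Σ i, Fin (α i) // k.1 = i} = α i := by
  rw [Fintype.card_congr (Equiv.sigmaSubtype i), Fintype.card_fin]

theorem gaussianMonomial_one_eq_card (α β : Fin n →₀ ℕ) :
    gaussianMonomial (1 : Matrix.GeneralLinearGroup (Fin n) R) α β =
      Fintype.card {s : (Σ i, Fin (α i)) ≃ (Σ i, Fin (β i)) // ∀ k, (s k).1 = k.1} := by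
  simp [gaussianMonomial, wickSum, Matrix.one_apply, Finset.prod_boole, Fintype.card_subtype]

theorem gaussianMonomial_one_self (α : Fin n →₀ ℕ) :
    gaussianMonomial (1 : Matrix.GeneralLinearGroup (Fin n) R) α α = mfactorial α := by
  have h_card := DomMulAct.stabilizer_card (f := (Sigma.fst : (Σ i, Fin (α i)) → Fin n))
  simp only [card_sigma_fin_fiber] at h_card
  rw [gaussianMonomial_one_eq_card, mfactorial, ← h_card]
  exact congr_arg Nat.cast <| Fintype.card_congr <|
    Equiv.subtypeEquivRight fun s => by simp [funext_iff]

theorem gaussianMonomial_one_of_ne {α β : Fin n →₀ ℕ} (h : α ≠ β) :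
    gaussianMonomial (1 : Matrix.GeneralLinearGroup (Fin n) R) α β = 0 := by
  have h_empty :
      IsEmpty {s : (Σ i, Fin (α i)) ≃ (Σ i, Fin (β i)) // ∀ k, (s k).1 = k.1} := by
    refine ⟨fun ⟨s, hs⟩ => h (Finsupp.ext fun i => ?_)⟩
    rw [← card_sigma_fin_fiber α i, ← card_sigma_fin_fiber β i]
    exact Fintype.card_congr (s.subtypeEquiv fun k => by rw [hs k])
  rw [gaussianMonomial_one_eq_card, Fintype.card_eq_zero, Nat.cast_zero]

end Wick

section USlice

variable {R : Type*} [CommRing R] {n : ℕ}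

theorem triple_inj {a b c a' b' c' : Fin n →₀ ℕ} :
    triple a b c = triple a' b' c' ↔ a = a' ∧ b = b' ∧ c = c' := by
  simp [triple, DFunLike.ext_iff, Sum.forall]

theorem triple_add_single_u (a b c : Fin n →₀ ℕ) (i : Fin n) (k : ℕ) :
    triple a (b + Finsupp.single i k) c = triple a b c + Finsupp.single (Var.u i) k := by
  ext (j | j | j) <;> simp [triple, Var.u, Finsupp.single_apply]

/-- The power series in `u` which multiplies `ū^a X^c` in an element of `R[[ū, u, X]]`. -/
noncomputable def uSlice (a c : Fin n →₀ ℕ) :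
    MvPowerSeries (Var n) R →ₗ[R] MvPowerSeries (Fin n) R where
  toFun U := fun b => coeff (triple a b c) U
  map_add' _ _ := rfl
  map_smul' _ _ := rfl

theorem coeff_uSlice (a b c : Fin n →₀ ℕ) (U : MvPowerSeries (Var n) R) :
    coeff b (uSlice a c U) = coeff (triple a b c) U := rfl

theorem uSlice_X_u_mul (a c : Fin n →₀ ℕ) (i : Fin n) (U : MvPowerSeries (Var n) R) :
    uSlice a c (X (Var.u i) * U) = X i * uSlice a c U := by
  ext b
  rw [coeff_uSlice]
  by_cases hi : b i = 0
  · rw [coeff_X_mul_of_eq_zero hi, coeff_X_mul_of_eq_zero]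
    exact hi
  · obtain ⟨e, rfl⟩ := exists_eq_add_single_one hi
    rw [triple_add_single_u, coeff_add_single_X_mul, coeff_add_single_X_mul, coeff_uSlice]

theorem hasSubst_X_u : HasSubst fun j : Fin n => (X (Var.u j) : MvPowerSeries (Var n) R) :=
  hasSubst_of_constantCoeff_zero fun _ => constantCoeff_X _

theorem inU_mul (H K : MvPowerSeries (Fin n) R) : inU (H * K) = inU H * inU K :=
  subst_mul hasSubst_X_u H K

theorem inU_mpow (G : Fin n → MvPowerSeries (Fin n) R) (α : Fin n →₀ ℕ) :
    inU (mpow G α) = mpow (fun i => inU (G i)) α := by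
  simp only [inU, ← coe_substAlgHom (R := R) hasSubst_X_u, map_mpow]

theorem inU_mpow_X (α : Fin n →₀ ℕ) :
    inU (mpow X α) = mpow (fun i => (X (Var.u i) : MvPowerSeries (Var n) R)) α :=
  subst_mpow_X hasSubst_X_u α

theorem uSlice_inU_mul (a c : Fin n →₀ ℕ) (H : MvPowerSeries (Fin n) R)
    (U : MvPowerSeries (Var n) R) : uSlice a c (inU H * U) = H * uSlice a c U := by
  have h : uSlice a c ∘ₗ LinearMap.mulRight R U ∘ₗ
        (substAlgHom (R := R) (hasSubst_X_u (R := R) (n := n))).toLinearMap =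
      LinearMap.mulRight R (uSlice a c U) := by
    refine linearMap_ext_of_X_mul ?_ fun i H => ⟨X i, H, constantCoeff_X i, ?_, mul_assoc _ _ _⟩
    · simp only [LinearMap.comp_apply, AlgHom.toLinearMap_apply, LinearMap.mulRight_apply, map_one,
        one_mul]
    · simp only [LinearMap.comp_apply, AlgHom.toLinearMap_apply, LinearMap.mulRight_apply, map_mul,
        substAlgHom_X, mul_assoc, uSlice_X_u_mul]
  rw [inU, ← coe_substAlgHom (R := R) hasSubst_X_u]
  exact LinearMap.congr_fun h H

theorem mpow_X_ubar_mul_mpow_X_x (a c : Fin n →₀ ℕ) :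
    mpow (fun i => (X (Var.ubar i) : MvPowerSeries (Var n) R)) a *
      mpow (fun i => X (Var.x i)) c = monomial (triple a 0 c) 1 := by
  rw [monomial_one_eq, Finsupp.prod_fintype _ _ (by simp)]
  simp [mpow, triple, Fintype.prod_sum_type, Var.ubar, Var.x]

theorem uSlice_mpow_X_ubar_mul_mpow_X_x_mul_inU (a c κ μ : Fin n →₀ ℕ)
    (H : MvPowerSeries (Fin n) R) :
    uSlice a c (mpow (fun i => X (Var.ubar i)) κ * mpow (fun i => X (Var.x i)) μ * inU H) =
      if a = κ ∧ c = μ then H else 0 := by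
  classical
  have h_one : uSlice a c (monomial (triple κ 0 μ) (1 : R)) =
      if a = κ ∧ c = μ then 1 else 0 := by
    ext b
    simp only [coeff_uSlice, coeff_monomial, triple_inj, apply_ite (coeff b), coeff_one, map_zero,
      ← ite_and]
    exact if_congr (by tauto) rfl rfl
  rw [mpow_X_ubar_mul_mpow_X_x, mul_comm, uSlice_inU_mul, h_one, mul_ite, mul_one, mul_zero]

end USlice

section GaussianIntegral

variable {R : Type*} [CommRing R] {n : ℕ} {U : MvPowerSeries (Var n) R}
  {p : (Fin n →₀ ℕ) → Fin n →₀ ℕ}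

theorem coeff_gaussianTerm (A : Matrix.GeneralLinearGroup (Fin n) R) (U : MvPowerSeries (Var n) R)
    (a b c d : Fin n →₀ ℕ) :
    coeff d (gaussianTerm A U (a, b, c)) =
      if d = c then coeff b (uSlice a c U) * gaussianMonomial A a b else 0 := by
  rw [gaussianTerm, coeff_monomial, coeff_uSlice]

theorem coeff_gaussianTerm_one_eq_zero (hU : ∀ a c, a ≠ p c → uSlice a c U = 0)
    (d : Fin n →₀ ℕ) {α : (Fin n →₀ ℕ) × (Fin n →₀ ℕ) × (Fin n →₀ ℕ)}
    (hα : α ≠ (p d, p d, d)) : coeff d (gaussianTerm 1 U α) = 0 := by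
  classical
  obtain ⟨a, b, c⟩ := α
  rw [coeff_gaussianTerm]
  split_ifs with hdc
  · subst hdc
    by_cases ha : a = p d
    · rw [gaussianMonomial_one_of_ne (by rintro rfl; exact hα (by rw [← ha])), mul_zero]
    · rw [hU a d ha, map_zero, zero_mul]
  · rfl

theorem gaussianIntegrable_one_of_uSlice_eq_zero (hU : ∀ a c, a ≠ p c → uSlice a c U = 0) :
    GaussianIntegrable 1 U := fun d =>
  (Set.finite_singleton (p d, p d, d)).subset fun _ =>
    not_imp_comm.1 (coeff_gaussianTerm_one_eq_zero hU d)

theorem coeff_gaussianIntegral_one (hU : ∀ a c, a ≠ p c → uSlice a c U = 0) (d : Fin n →₀ ℕ) :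
    coeff d (gaussianIntegral 1 U) = mfactorial (p d) * coeff (p d) (uSlice (p d) d U) := by
  classical
  change ∑ᶠ α, coeff d (gaussianTerm 1 U α) = _
  rw [finsum_eq_single _ (p d, p d, d) fun α => coeff_gaussianTerm_one_eq_zero hU d,
    coeff_gaussianTerm, if_pos rfl, gaussianMonomial_one_self, mul_comm]

end GaussianIntegral

section Interaction

variable {R : Type*} [CommRing R] {n : ℕ}

theorem uSlice_interaction_pow (G : Fin n → MvPowerSeries (Fin n) R) (a c : Fin n →₀ ℕ) (k : ℕ) :
    uSlice a c ((∑ i, X (Var.ubar i) * X (Var.x i) * inU (G i)) ^ k) =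
      if a = c ∧ k = a.degree then Nat.multinomial Finset.univ a • mpow G a else 0 := by
  classical
  have h_term (κ : Fin n → ℕ) :
      uSlice a c ((Nat.multinomial Finset.univ κ : MvPowerSeries (Var n) R) *
        ∏ i, (X (Var.ubar i) * X (Var.x i) * inU (G i)) ^ κ i) =
      if κ = a then if a = c then Nat.multinomial Finset.univ a • mpow G a else 0 else 0 := by
    obtain ⟨κ, rfl⟩ : ∃ κ' : Fin n →₀ ℕ, ⇑κ' = κ := ⟨Finsupp.equivFunOnFinite.symm κ, rfl⟩
    have h_prod : ∏ i, (X (Var.ubar i) * X (Var.x i) * inU (G i)) ^ κ i =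
        mpow (fun i => X (Var.ubar i)) κ * mpow (fun i => X (Var.x i)) κ * inU (mpow G κ) := by
      rw [inU_mpow]
      simp only [mpow, mul_pow, Finset.prod_mul_distrib]
    rw [← nsmul_eq_mul, map_nsmul, h_prod,
      uSlice_mpow_X_ubar_mul_mpow_X_x_mul_inU]
    rcases eq_or_ne κ a with rfl | h
    · simp [eq_comm]
    · simp [h, h.symm]
  rw [Finset.sum_pow_eq_sum_piAntidiag, map_sum, Finset.sum_congr rfl fun κ _ => h_term κ,
    Finset.sum_ite_eq', ← ite_and, Finsupp.degree_eq_sum]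
  exact if_congr (by simp [eq_comm, and_comm]) rfl rfl

variable [Algebra ℚ R]

theorem uSlice_expInteraction (G : Fin n → MvPowerSeries (Fin n) R) (a c : Fin n →₀ ℕ) :
    uSlice a c (expInteraction G) =
      if a = c then algebraMap ℚ R (1 / mfactorial a) • mpow G a else 0 := by
  have h_subst : PowerSeries.HasSubst
      (∑ i, X (Var.ubar i) * X (Var.x i) * inU (G i) : MvPowerSeries (Var n) R) :=
    PowerSeries.HasSubst.of_constantCoeff_zero (by simp)
  ext b
  rw [coeff_uSlice, expInteraction, PowerSeries.coeff_subst h_subst]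
  simp only [← coeff_uSlice, uSlice_interaction_pow, PowerSeries.coeff_exp]
  split_ifs with h
  · rw [finsum_eq_single _ a.degree fun k hk => by simp [hk], if_pos ⟨h, rfl⟩, map_nsmul,
      nsmul_eq_mul, coeff_smul, smul_eq_mul, ← mul_assoc,
      algebraMap_one_div_degree_factorial_mul_multinomial]
  · simp [h]

theorem uSlice_inU_mul_expInteraction (G : Fin n → MvPowerSeries (Fin n) R)
    (H : MvPowerSeries (Fin n) R) (a c : Fin n →₀ ℕ) :
    uSlice a c (inU H * expInteraction G) =
      if a = c then algebraMap ℚ R (1 / mfactorial a) • (H * mpow G a) else 0 := by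
  rw [uSlice_inU_mul, uSlice_expInteraction, mul_ite, mul_smul_comm, mul_zero]

theorem gaussianIntegrable_inU_mul_expInteraction (G : Fin n → MvPowerSeries (Fin n) R)
    (H : MvPowerSeries (Fin n) R) : GaussianIntegrable 1 (inU H * expInteraction G) :=
  gaussianIntegrable_one_of_uSlice_eq_zero (p := id) fun a c hac => by
    rw [uSlice_inU_mul_expInteraction, if_neg (id hac : a ≠ c)]

theorem gaussianIntegral_inU_mul_expInteraction (G : Fin n → MvPowerSeries (Fin n) R)
    (H : MvPowerSeries (Fin n) R) :
    gaussianIntegral 1 (inU H * expInteraction G) = lagrangeSeries G H := by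
  ext d
  rw [coeff_gaussianIntegral_one (p := id) fun a c hac => by
      rw [uSlice_inU_mul_expInteraction, if_neg (id hac : a ≠ c)],
    id, uSlice_inU_mul_expInteraction, if_pos rfl, coeff_smul, ← mul_assoc,
    mul_comm (mfactorial d : R), algebraMap_one_div_mfactorial_mul, one_mul, coeff_lagrangeSeries,
    mpow]

end Interaction

section GaussianDerivative

variable {R : Type*} [CommRing R] {n : ℕ}

theorem uSlice_mpow_X_ubar_mul_inU_mul_mpow_inU (G : Fin n → MvPowerSeries (Fin n) R)
    (α : Fin n →₀ ℕ) (H : MvPowerSeries (Fin n) R) (a c : Fin n →₀ ℕ) :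
    uSlice a c (mpow (fun i => X (Var.ubar i)) α * inU H * mpow (fun i => inU (G i)) α) =
      if a = α ∧ c = 0 then H * mpow G α else 0 := by
  rw [← uSlice_mpow_X_ubar_mul_mpow_X_x_mul_inU, inU_mul, inU_mpow, mul_assoc]
  simp [mpow]

theorem gaussianIntegrable_mpow_X_ubar_mul_inU_mul_mpow_inU (G : Fin n → MvPowerSeries (Fin n) R)
    (α : Fin n →₀ ℕ) (H : MvPowerSeries (Fin n) R) :
    GaussianIntegrable 1
      (mpow (fun i => X (Var.ubar i)) α * inU H * mpow (fun i => inU (G i)) α) :=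
  gaussianIntegrable_one_of_uSlice_eq_zero (p := fun _ => α) fun a c ha => by
    rw [uSlice_mpow_X_ubar_mul_inU_mul_mpow_inU, if_neg fun h => ha h.1]

theorem gaussianIntegral_mpow_X_ubar_mul_inU_mul_mpow_inU (G : Fin n → MvPowerSeries (Fin n) R)
    (α : Fin n →₀ ℕ) (H : MvPowerSeries (Fin n) R) :
    gaussianIntegral 1
        (mpow (fun i => X (Var.ubar i)) α * inU H * mpow (fun i => inU (G i)) α) =
      C (derivAtZero α (H * mpow G α)) := by
  classical
  ext d
  rw [coeff_gaussianIntegral_one (p := fun _ => α) fun a c ha => by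
      rw [uSlice_mpow_X_ubar_mul_inU_mul_mpow_inU, if_neg fun h => ha h.1],
    uSlice_mpow_X_ubar_mul_inU_mul_mpow_inU, coeff_C, derivAtZero_eq]
  by_cases hd : d = 0 <;> simp [hd]

end GaussianDerivative

section TaylorExpansion

variable {R : Type*} [CommRing R]

theorem formallySummable_monomial {σ : Type*} (f : (σ →₀ ℕ) → R) :
    FormallySummable fun α => monomial α (f α) := by
  classical
  exact fun d => (Set.finite_singleton d).subset fun α =>
    not_imp_comm.1 fun hα => coeff_monomial_ne (Ne.symm hα) _

theorem coeff_formalSum_monomial {σ : Type*} (f : (σ →₀ ℕ) → R) (d : σ →₀ ℕ) :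
    coeff d (formalSum fun α => monomial α (f α)) = f d := by
  change ∑ᶠ α, coeff d (monomial α (f α)) = f d
  rw [finsum_eq_single _ d fun α hα => coeff_monomial_ne hα.symm _, coeff_monomial_same]

theorem lagrangeSeries_eq_formalSum [Algebra ℚ R] {n : ℕ} (G : Fin n → MvPowerSeries (Fin n) R)
    (H : MvPowerSeries (Fin n) R) :
    lagrangeSeries G H = formalSum fun α : Fin n →₀ ℕ => monomial α
      (algebraMap ℚ R (1 / (mfactorial α : ℚ)) * derivAtZero α (H * mpow G α)) := by
  ext d
  rw [coeff_formalSum_monomial, derivAtZero_eq, coeff_lagrangeSeries, ← mul_assoc,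
    algebraMap_one_div_mfactorial_mul, one_mul, mpow]

end TaylorExpansion

end LagrangeGood

theorem theorem9_general {R : Type*} [CommRing R] [Algebra ℚ R] (n : ℕ)
    (G : Fin n → MvPowerSeries (Fin n) R) :
    (∃! F : Fin n → MvPowerSeries (Fin n) R, IsImplicitSolution G F) ∧
    ∀ F : Fin n → MvPowerSeries (Fin n) R, IsImplicitSolution G F →
      IsUnit (1 - xJacobian G F).det ∧
      ∀ Ω : MvPowerSeries (Fin n) R,
        GaussianIntegrable 1 (inU Ω * expInteraction G) ∧
        MvPowerSeries.subst F Ω * Ring.inverse (1 - xJacobian G F).det =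
          gaussianIntegral 1 (inU Ω * expInteraction G) ∧
        (∀ α : Fin n →₀ ℕ,
          GaussianIntegrable 1
            (mpow (fun i => MvPowerSeries.X (Var.ubar i)) α * inU Ω *
              mpow (fun i => inU (G i)) α) ∧
          gaussianIntegral 1
            (mpow (fun i => MvPowerSeries.X (Var.ubar i)) α * inU Ω *
              mpow (fun i => inU (G i)) α) =
            MvPowerSeries.C (derivAtZero α (Ω * mpow G α))) ∧
        FormallySummable (fun α : Fin n →₀ ℕ =>
          MvPowerSeries.monomial α (algebraMap ℚ R (1 / (mfactorial α : ℚ)) *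
            derivAtZero α (Ω * mpow G α))) ∧
        gaussianIntegral 1 (inU Ω * expInteraction G) =
          formalSum (fun α : Fin n →₀ ℕ =>
            MvPowerSeries.monomial α (algebraMap ℚ R (1 / (mfactorial α : ℚ)) *
              derivAtZero α (Ω * mpow G α))) := by
  have : IsAddTorsionFree R := IsAddTorsionFree.of_module_rat R
  refine ⟨existsUnique_isImplicitSolution G, fun F hF => ⟨hF.isUnit_det, fun Ω => ?_⟩⟩
  rw [gaussianIntegral_inU_mul_expInteraction]
  exact ⟨gaussianIntegrable_inU_mul_expInteraction G Ω,
    (hF.lagrangeSeries_eq_subst_mul_inverse_det Ω).symm,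
    fun α => ⟨gaussianIntegrable_mpow_X_ubar_mul_inU_mul_mpow_inU G α Ω,
      gaussianIntegral_mpow_X_ubar_mul_inU_mul_mpow_inU G α Ω⟩,
    formallySummable_monomial _, lagrangeSeries_eq_formalSum G Ω⟩

theorem theorem9 {R : Type*} [CommRing R] [Algebra ℚ R] (n : ℕ)
    (G : Fin n → MvPowerSeries (Fin n) R) :
    (∃! F : Fin n → MvPowerSeries (Fin n) R, IsImplicitSolution G F) ∧
    ∀ F : Fin n → MvPowerSeries (Fin n) R, IsImplicitSolution G F →
      IsUnit (1 - xJacobian G F).det ∧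
      ∀ β : Fin n →₀ ℕ,
        -- the integral converges, and equals `Ω(F) / det(I - X∂G(F))` for `Ω(u) = u^β`
        GaussianIntegrable 1
          (mpow (fun i => MvPowerSeries.X (Var.u i)) β * expInteraction G) ∧
        mpow F β * Ring.inverse (1 - xJacobian G F).det =
          gaussianIntegral 1
            (mpow (fun i => MvPowerSeries.X (Var.u i)) β * expInteraction G) ∧
        -- each coefficient of the expansion is a well-defined integral with values in `R`
        (∀ α : Fin n →₀ ℕ,
          GaussianIntegrable 1
            (mpow (fun i => MvPowerSeries.X (Var.ubar i)) α *
              mpow (fun i => MvPowerSeries.X (Var.u i)) β * mpow (fun i => inU (G i)) α) ∧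
          gaussianIntegral 1
            (mpow (fun i => MvPowerSeries.X (Var.ubar i)) α *
              mpow (fun i => MvPowerSeries.X (Var.u i)) β * mpow (fun i => inU (G i)) α) =
            MvPowerSeries.C (derivAtZero α (mpow MvPowerSeries.X β * mpow G α))) ∧
        -- the expansion `∑_α X^α / α! · ∂^α|_{u=0} [Ω(u) G(u)^α]`
        FormallySummable (fun α : Fin n →₀ ℕ =>
          MvPowerSeries.monomial α (algebraMap ℚ R (1 / (mfactorial α : ℚ)) *
            derivAtZero α (mpow MvPowerSeries.X β * mpow G α))) ∧
        gaussianIntegral 1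
            (mpow (fun i => MvPowerSeries.X (Var.u i)) β * expInteraction G) =
          formalSum (fun α : Fin n →₀ ℕ =>
            MvPowerSeries.monomial α (algebraMap ℚ R (1 / (mfactorial α : ℚ)) *
              derivAtZero α (mpow MvPowerSeries.X β * mpow G α))) := by
  obtain ⟨h_unique, h⟩ := theorem9_general n G
  refine ⟨h_unique, fun F hF => ⟨(h F hF).1, fun β => ?_⟩⟩
  simpa only [inU_mpow_X, subst_mpow_X hF.hasSubst] using (h F hF).2 (mpow MvPowerSeries.X β)
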